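/- Let $a_0:\mathbb{R}\to\mathbb{R}$ be a $C^\infty$, $\pi$-periodic function with $a_0>0$ and $a_0+a_0''>0$, and let $f:[0,\infty)\to\mathbb{R}$ be $C^\infty$, positive and nondecreasing with $f(0)=1$. Put $a(\theta,t)=f(t)\,a_0(\theta)$; for each $t$ this is the support function of the unit ball of a norm on $\mathbb{R}^2$, with boundary $p(\theta,t)=a(\theta,t)(\cos\theta,\sin\theta)+a'(\theta,t)(-\sin\theta,\cos\theta)$. Here $'$ denotes $\partial/\partial\theta$, and $S^1=\mathbb{R}/2\pi\mathbb{Z}$. Let $0<T<\infty$ and let $k:S^1\times[0,T)\to\mathbb{R}$ be continuous together with $k'$, $k''$ and $\partial k/\partial t$ (one-sided at $t=0$). Suppose that on $S^1\times[0,T)$ $$\frac{\partial k}{\partial t}=\frac{a}{a+a''}k^2k''+\frac{2a'}{a+a''}k^2k'+k^3+\frac{\partial\log(a+a'')}{\partial t}\,k ,$$ that $k(\theta,0)>0$ for all $\theta$, and that $$\int_0^{2\pi}\frac{a(\theta,0)+a''(\theta,0)}{k(\theta,0)}\sin\theta\,d\theta=\int_0^{2\pi}\frac{a(\theta,0)+a''(\theta,0)}{k(\theta,0)}\cos\theta\,d\theta=0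 .$$ Let $F(\cdot,t)$ be the associated evolving curves, whose Minkowskian curvature with respect to the norm at time $t$ is $k(\cdot,t)$: $$F(\theta,t)=\Big(-\int_0^\theta\frac{a+a''}{k}(\sigma,t)\sin\sigma\,d\sigma-\int_0^t a(0,s)k(0,s)\,ds,\ \int_0^\theta\frac{a+a''}{k}(\sigma,t)\cos\sigma\,d\sigma-\int_0^t\big(a(0,s)k'(0,s)+a'(0,s)k(0,s)\big)\,ds\Big),$$ and let $A(t)=\frac12\int_0^{2\pi}\big[F(\theta,t),\tfrac{\partial F}{\partial\theta}(\theta,t)\big]\,d\theta$ be the area enclosed by $F(\cdot,t)$, where $[x,y]=x_1y_2-x_2y_1$. If there is a constant $c>0$ such that $A(t)\ge c$ for all $t\in[0,T)$, then $k$ is uniformly bounded: there is a constant $C$ such that $|k(\theta,t)|\le C$ for all $(\theta,t)\in S^1\times[0,T)$. -/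

import Mathlib

open scoped ContDiff
open Set

noncomputable section

namespace MinkowskiFlow

/-- Points of `S¹` are represented by real angles: a function on `S¹ × [0, T)` is a function
`g θ t` of two real variables that is `2π`-periodic in `θ` and is only looked at for
`t ∈ [0, T)`.  `dθ g θ t` is the first spatial derivative `g'(θ, t)`. -/
def dθ (g : ℝ → ℝ → ℝ) (θ t : ℝ) : ℝ := deriv (fun σ => g σ t) θ

/-- The second spatial derivative `g''(θ, t)`. -/
def dθθ (g : ℝ → ℝ → ℝ) (θ t : ℝ) : ℝ := iteratedDeriv 2 (fun σ => g σ t) θ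

/-- The time derivative on `[0, T)`, one-sided at `t = 0`. -/
def dt (T : ℝ) (g : ℝ → ℝ → ℝ) (θ t : ℝ) : ℝ := derivWithin (fun s => g θ s) (Ico 0 T) t

/-- The homothetic family of support functions `a(θ, t) = f(t) a₀(θ)`. -/
def homothetic (f a₀ : ℝ → ℝ) (θ t : ℝ) : ℝ := f t * a₀ θ

/-- The class `C^{2,1}` on `S¹ × [0, T)`: the function is `2π`-periodic in `θ`, twice
differentiable in `θ` and once in `t`, and `g, g', g'', ∂g/∂t` are jointly continuous. -/
structure IsC21 (T : ℝ) (g : ℝ → ℝ → ℝ) : Prop where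
  periodic : ∀ t ∈ Ico 0 T, Function.Periodic (fun θ => g θ t) (2 * Real.pi)
  contDiff_space : ∀ t ∈ Ico 0 T, ContDiff ℝ 2 (fun θ => g θ t)
  differentiable_time : ∀ θ, DifferentiableOn ℝ (fun t => g θ t) (Ico 0 T)
  continuous : ContinuousOn (fun z : ℝ × ℝ => g z.1 z.2) (univ ×ˢ Ico 0 T)
  continuous_dθ : ContinuousOn (fun z : ℝ × ℝ => dθ g z.1 z.2) (univ ×ˢ Ico 0 T)
  continuous_dθθ : ContinuousOn (fun z : ℝ × ℝ => dθθ g z.1 z.2) (univ ×ˢ Ico 0 T)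
  continuous_dt : ContinuousOn (fun z : ℝ × ℝ => dt T g z.1 z.2) (univ ×ˢ Ico 0 T)

/-- `k` is a solution on `S¹ × [0, T)` of the evolution equation of the Minkowskian curvature
for the norms with support functions `a(·, t)`,
`k_t = a/(a+a'') k² k'' + 2a'/(a+a'') k² k' + k³ + (∂ log(a+a'')/∂t) k`,
whose initial value is positive and is the Minkowskian curvature of a closed curve. -/
structure IsCurvatureSolution (a : ℝ → ℝ → ℝ) (T : ℝ) (k : ℝ → ℝ → ℝ) : Prop where
  regular : IsC21 T k
  evolution : ∀ θ, ∀ t ∈ Ico 0 T,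
    dt T k θ t =
      a θ t / (a θ t + dθθ a θ t) * k θ t ^ 2 * dθθ k θ t
        + 2 * dθ a θ t / (a θ t + dθθ a θ t) * k θ t ^ 2 * dθ k θ t
        + k θ t ^ 3
        + dt T (fun φ s => Real.log (a φ s + dθθ a φ s)) θ t * k θ t
  initial_pos : ∀ θ, 0 < k θ 0
  initial_closed_sin :
    ∫ θ in (0 : ℝ)..(2 * Real.pi), (a θ 0 + dθθ a θ 0) / k θ 0 * Real.sin θ = 0
  initial_closed_cos :
    ∫ θ in (0 : ℝ)..(2 * Real.pi), (a θ 0 + dθθ a θ 0) / k θ 0 * Real.cos θ = 0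

/-- The curves `θ ↦ F(θ, t)` associated to the curvature function `k`: the tangent
`∂F/∂θ = ((a + a'')/k) (-sin θ, cos θ)` gives `F(·, t)` the Minkowskian curvature `k(·, t)` with
respect to the norm with support function `a(·, t)`, and the time integrals are the motion of
the point `θ = 0`. -/
def curve (a k : ℝ → ℝ → ℝ) (θ t : ℝ) : ℝ × ℝ :=
  (-(∫ σ in (0 : ℝ)..θ, (a σ t + dθθ a σ t) / k σ t * Real.sin σ)
      - ∫ s in (0 : ℝ)..t, a 0 s * k 0 s,
   (∫ σ in (0 : ℝ)..θ, (a σ t + dθθ a σ t) / k σ t * Real.cos σ)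
      - ∫ s in (0 : ℝ)..t, (a 0 s * dθ k 0 s + dθ a 0 s * k 0 s))

/-- The determinant `[x, y]` of two plane vectors. -/
def bracket (x y : ℝ × ℝ) : ℝ := x.1 * y.2 - x.2 * y.1

/-- The area enclosed by a closed, positively oriented curve `γ : [0, 2π] → ℝ²`. -/
def enclosedArea (γ : ℝ → ℝ × ℝ) : ℝ :=
  1 / 2 * ∫ θ in (0 : ℝ)..(2 * Real.pi), bracket (γ θ) (deriv γ θ)

end MinkowskiFlow

end

namespace MinkowskiFlow

open Filter Topology MeasureTheory

noncomputable section

/-! For a homothetic family the moving norm can be scaled away. With `U = a₀ k / f`, the logarithmic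
term cancels and the equation becomes `U_t = g U² / b (U'' + U)`, where `g = f²` and `b = a₀ (a₀ +
a₀'')`. This is anisotropic curvature flow of a convex curve with Euclidean radius of curvature `r =
b / U` and inward normal speed `g U`, so its support function `S` satisfies `S'' + S = r` and `S_t =
-g U`.

The maximum principle keeps `U` positive. Hence `S` decreases in time, the enclosed regions are
nested, and by Cauchy's formula the length never exceeds its initial value `L`. About the centroid
of its boundary, a convex curve has support function between area/length and length. The area bound
`c` thus gives at each time a disc of radius `2ρ = c / L` inside the curve, and by nesting inside
all earlier curves.

The upper bound is Tso's trick (`speed_lt_mul_support`): apply the maximum principle to `U - B (S -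
ρ)`, with `S` taken about the centre of that disc. At a first contact the spatial second-order
condition and `S'' + S = r` give `U'' + U ≤ B (b / U - ρ)`, so the time derivative is at most `g U B
/ b (2b - ρ U)`, which is negative once `B` is large. Since `B` depends only on the data at time
zero and on `c`, `U ≤ B L` uniformly. Finally `k = f U / a₀`, with `f` and `1 / a₀` bounded. -/

/-! ### Parabolic maximum principle on the circle -/

theorem IsLocalMax.deriv_deriv_nonpos {f : ℝ → ℝ} {x : ℝ} (h : IsLocalMax f x)
    (hc : ContinuousAt f x) : deriv (deriv f) x ≤ 0 := by
  by_contra! hpos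
  have hmin := isLocalMin_of_deriv_deriv_pos hpos h.deriv_eq_zero hc
  -- A local maximum that is also a local minimum is locally constant, so the second derivative
  -- would vanish.
  have heq : f =ᶠ[𝓝 x] fun _ => f x := by
    filter_upwards [h, hmin] with y h1 h2 using le_antisymm h1 h2
  have := heq.deriv.deriv_eq
  simp at this
  linarith

theorem deriv_nonneg_of_le_left {f : ℝ → ℝ} {f' t₀ t : ℝ} (ht : t₀ < t) (hf : HasDerivAt f f' t)
    (h : ∀ s ∈ Ico t₀ t, f s ≤ f t) : 0 ≤ f' := by
  have hw := (hasDerivWithinAt_iff_tendsto_slope' (s := Iio t) (by simp)).1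
    (hf.hasDerivWithinAt (s := Iio t))
  refine ge_of_tendsto hw ?_
  filter_upwards [Ioo_mem_nhdsLT ht] with s hs
  rw [slope_def_field]
  exact div_nonneg_of_nonpos (by linarith [h s ⟨hs.1.le, hs.2⟩]) (by linarith [hs.2])

/-- If a function on `S¹ × [0, t₁]` which is negative initially fails to stay negative, then it has
a first zero. -/
theorem neg_of_no_first_contact {v : ℝ → ℝ → ℝ} {t₁ : ℝ}
    (hc : ContinuousOn (fun z : ℝ × ℝ => v z.1 z.2) (univ ×ˢ Icc 0 t₁))
    (hper : ∀ t ∈ Icc 0 t₁, Function.Periodic (fun θ => v θ t) (2 * Real.pi))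
    (h0 : ∀ θ, v θ 0 < 0)
    (hcontact : ∀ t ∈ Ioc 0 t₁, ∀ θ, v θ t = 0 → (∀ φ, v φ t ≤ 0) →
      (∀ s ∈ Ico 0 t, v θ s ≤ 0) → False) :
    ∀ θ, ∀ t ∈ Icc 0 t₁, v θ t < 0 := by
  by_contra! hcon
  obtain ⟨θ', t', ht', hv'⟩ := hcon
  set K : Set (ℝ × ℝ) := Icc 0 (2 * Real.pi) ×ˢ Icc 0 t₁ with hK
  have hKc : IsCompact K := isCompact_Icc.prod isCompact_Icc
  have hcK : ContinuousOn (fun z : ℝ × ℝ => v z.1 z.2) K :=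
    hc.mono (prod_mono (subset_univ _) le_rfl)
  have hS : IsCompact (K ∩ (fun z : ℝ × ℝ => v z.1 z.2) ⁻¹' Ici 0) :=
    hKc.of_isClosed_subset (hcK.preimage_isClosed_of_isClosed hKc.isClosed isClosed_Ici)
      inter_subset_left
  have hred : ∀ θ, ∀ t ∈ Icc 0 t₁, 0 ≤ v θ t →
      ∃ φ, (φ, t) ∈ K ∩ (fun z : ℝ × ℝ => v z.1 z.2) ⁻¹' Ici 0 := by
    intro θ t ht hv
    obtain ⟨φ, hφ, he⟩ := (hper t ht).exists_mem_Ico₀ (by positivity) θ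
    refine ⟨φ, ⟨⟨⟨hφ.1, hφ.2.le⟩, ht⟩, ?_⟩⟩
    simp only [mem_preimage, mem_Ici]
    rwa [← he]
  obtain ⟨φ', hφ'⟩ := hred θ' t' ht' hv'
  -- The earliest contact: time attains its minimum on the set where `v ≥ 0`, compact after
  -- reduction to one period.
  obtain ⟨⟨θ₀, t₀⟩, hz, hmin⟩ := hS.exists_isMinOn ⟨_, hφ'⟩ continuous_snd.continuousOn
  have ht₀ : t₀ ∈ Icc 0 t₁ := hz.1.2
  have hv₀ : 0 ≤ v θ₀ t₀ := hz.2
  have hbefore : ∀ φ, ∀ s ∈ Ico 0 t₀, v φ s < 0 := by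
    intro φ s hs
    by_contra! hcon
    obtain ⟨ψ, hψ⟩ := hred φ s ⟨hs.1, hs.2.le.trans ht₀.2⟩ hcon
    have : t₀ ≤ s := hmin hψ
    linarith [hs.2]
  have hpos : 0 < t₀ := by
    rcases ht₀.1.eq_or_lt with h | h
    · subst h; linarith [h0 θ₀]
    · exact h
  have hle : ∀ φ, v φ t₀ ≤ 0 := by
    intro φ
    have hcφ : ContinuousWithinAt (fun s => v φ s) (Icc 0 t₁) t₀ :=
      (hc.comp (f := fun s => (φ, s)) (by fun_prop) (fun s hs => ⟨mem_univ _, hs⟩)) t₀ ht₀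
    have hcφ' : ContinuousWithinAt (fun s => v φ s) (Ioo 0 t₀) t₀ :=
      hcφ.mono (fun s hs => ⟨hs.1.le, hs.2.le.trans ht₀.2⟩)
    have hne : (𝓝[Ioo 0 t₀] t₀).NeBot := by
      rw [nhdsWithin_Ioo_eq_nhdsLT hpos]; infer_instance
    refine le_of_tendsto hcφ' ?_
    filter_upwards [self_mem_nhdsWithin] with s hs
    exact (hbefore φ s ⟨hs.1.le, hs.2⟩).le
  exact hcontact t₀ ⟨hpos, ht₀.2⟩ θ₀ (le_antisymm (hle θ₀) hv₀) hle
    fun s hs => (hbefore θ₀ s hs).le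

/-- Parabolic maximum principle on `S¹ × [0, t₁]` in first-contact form. -/
theorem neg_of_deriv_time_neg_at_contact {v v₁ v₂ vt : ℝ → ℝ → ℝ} {t₁ : ℝ}
    (hc : ContinuousOn (fun z : ℝ × ℝ => v z.1 z.2) (univ ×ˢ Icc 0 t₁))
    (hper : ∀ t ∈ Icc 0 t₁, Function.Periodic (fun θ => v θ t) (2 * Real.pi))
    (h0 : ∀ θ, v θ 0 < 0)
    (h₁ : ∀ t ∈ Ioc 0 t₁, ∀ θ, HasDerivAt (fun φ => v φ t) (v₁ θ t) θ)
    (h₂ : ∀ t ∈ Ioc 0 t₁, ∀ θ, HasDerivAt (fun φ => v₁ φ t) (v₂ θ t) θ)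
    (ht : ∀ t ∈ Ioc 0 t₁, ∀ θ, HasDerivAt (fun s => v θ s) (vt θ t) t)
    (hcontact : ∀ t ∈ Ioc 0 t₁, ∀ θ, v θ t = 0 → v₁ θ t = 0 → v₂ θ t ≤ 0 → vt θ t < 0) :
    ∀ θ, ∀ t ∈ Icc 0 t₁, v θ t < 0 := by
  refine neg_of_no_first_contact hc hper h0 fun t htm θ hz hmax hprev => ?_
  have hloc : IsLocalMax (fun φ => v φ t) θ :=
    Eventually.of_forall fun φ => by simpa [hz] using hmax φ
  have hd : deriv (fun φ => v φ t) = fun φ => v₁ φ t := funext fun φ => (h₁ t htm φ).deriv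
  have e₁ := hloc.hasDerivAt_eq_zero (h₁ t htm θ)
  have e₂ := IsLocalMax.deriv_deriv_nonpos hloc (h₁ t htm θ).continuousAt
  rw [hd, (h₂ t htm θ).deriv] at e₂
  have e₃ := deriv_nonneg_of_le_left htm.1 (ht t htm θ)
    fun s hs => (hprev s hs).trans hz.ge
  linarith [hcontact t htm θ hz e₁ e₂]

theorem exists_forall_le_of_periodic {p : ℝ → ℝ} (hc : Continuous p)
    (hp : Function.Periodic p (2 * Real.pi)) : ∃ θ₀, ∀ θ, p θ ≤ p θ₀ := by
  obtain ⟨θ₀, -, hθ₀⟩ := isCompact_Icc.exists_isMaxOn (s := Icc 0 (2 * Real.pi))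
    ⟨0, by simp [Real.pi_pos.le]⟩ hc.continuousOn
  refine ⟨θ₀, fun θ => ?_⟩
  obtain ⟨φ, hφ, he⟩ := hp.exists_mem_Ico₀ (by positivity) θ
  rw [he]
  exact hθ₀ ⟨hφ.1, hφ.2.le⟩

/-! ### Continuity and differentiation of integrals with a parameter -/

section ParametricIntegrals

variable {P P' : ℝ → ℝ → ℝ} {p : ℝ → ℝ} {T : ℝ}

theorem continuousOn_slice (hP : ContinuousOn (fun z : ℝ × ℝ => P z.1 z.2) (univ ×ˢ Ico 0 T))
    {t : ℝ} (ht : t ∈ Ico 0 T) : Continuous fun θ => P θ t := by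
  rw [← continuousOn_univ]
  exact hP.comp (f := fun θ => (θ, t)) (by fun_prop) (fun θ _ => ⟨mem_univ _, ht⟩)

theorem continuousOn_univ_prod_Ico {f : ℝ × ℝ → ℝ}
    (h : ∀ t₁ ∈ Ico 0 T, ContinuousOn f (univ ×ˢ Icc 0 t₁)) :
    ContinuousOn f (univ ×ˢ Ico 0 T) := by
  rintro ⟨θ, t⟩ ⟨-, ht⟩
  simp only at ht
  obtain ⟨t₁, h₁, h₂⟩ := exists_between ht.2
  refine (h t₁ ⟨ht.1.trans h₁.le, h₂⟩ (θ, t) ⟨mem_univ _, ht.1, h₁.le⟩).mono_of_mem_nhdsWithin ?_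
  have : univ ×ˢ Iio t₁ ∈ 𝓝 (θ, t) := prod_mem_nhds univ_mem (Iio_mem_nhds h₁)
  filter_upwards [mem_nhdsWithin_of_mem_nhds this, self_mem_nhdsWithin] with z hz hz'
  exact ⟨mem_univ _, hz'.2.1, hz.2.le⟩

theorem continuousOn_integral_space
    (hP : ContinuousOn (fun z : ℝ × ℝ => P z.1 z.2) (univ ×ˢ Ico 0 T)) :
    ContinuousOn (fun z : ℝ × ℝ => ∫ σ in (0 : ℝ)..z.1, P σ z.2) (univ ×ˢ Ico 0 T) := by
  refine continuousOn_univ_prod_Ico fun t₁ ht₁ => ?_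
  -- Clamping time to `[0, t₁]` extends the integrand continuously to all times without changing it
  -- there.
  have hclamp : ∀ s, max 0 (min s t₁) ∈ Ico 0 T := fun s =>
    ⟨le_max_left _ _, max_lt (ht₁.1.trans_lt ht₁.2) ((min_le_right _ _).trans_lt ht₁.2)⟩
  have hcont : Continuous fun z : (ℝ × ℝ) × ℝ => P z.2 (max 0 (min z.1.2 t₁)) := by
    rw [← continuousOn_univ]
    exact hP.comp (f := fun z : (ℝ × ℝ) × ℝ => (z.2, max 0 (min z.1.2 t₁))) (by fun_prop)
      fun z _ => ⟨mem_univ _, hclamp _⟩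
  have := intervalIntegral.continuous_parametric_intervalIntegral_of_continuous
    (μ := volume) (a₀ := 0) (f := fun (z : ℝ × ℝ) σ => P σ (max 0 (min z.2 t₁))) hcont
    (s := fun z => z.1) continuous_fst
  refine this.continuousOn.congr fun z hz => ?_
  have hz2 : z.2 ∈ Icc 0 t₁ := hz.2
  simp [min_eq_left hz2.2, max_eq_right hz2.1]

theorem continuousOn_integral_time (hp : ContinuousOn p (Ico 0 T)) :
    ContinuousOn (fun t => ∫ s in (0 : ℝ)..t, p s) (Ico 0 T) := by
  intro t ht
  obtain ⟨t₁, h₁, h₂⟩ := exists_between ht.2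
  have h0 : 0 ≤ t₁ := ht.1.trans h₁.le
  have hsub : Icc 0 t₁ ⊆ Ico 0 T := fun s hs => ⟨hs.1, hs.2.trans_lt h₂⟩
  have hi : IntegrableOn p (uIcc 0 t₁) := by
    rw [uIcc_of_le h0]
    exact (hp.mono hsub).integrableOn_Icc
  have := intervalIntegral.continuousOn_primitive_interval hi
  rw [uIcc_of_le h0] at this
  refine (this t ⟨ht.1, h₁.le⟩).mono_of_mem_nhdsWithin ?_
  filter_upwards [mem_nhdsWithin_of_mem_nhds (Iio_mem_nhds h₁), self_mem_nhdsWithin] with s hs hs'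
  exact ⟨hs'.1, hs.le⟩

theorem hasDerivAt_integral_time (hp : ContinuousOn p (Ico 0 T)) {t : ℝ} (ht : t ∈ Ioo 0 T) :
    HasDerivAt (fun t => ∫ s in (0 : ℝ)..t, p s) (p t) t := by
  have hsub : Icc 0 t ⊆ Ico 0 T := fun s hs => ⟨hs.1, hs.2.trans_lt ht.2⟩
  have hmem : Ico 0 T ∈ 𝓝 t := Ico_mem_nhds ht.1 ht.2
  refine intervalIntegral.integral_hasDerivAt_right ?_ ?_ (hp.continuousAt hmem)
  · exact ((hp.mono hsub).intervalIntegrable_of_Icc ht.1.le)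
  · exact ⟨Ico 0 T, hmem, hp.aestronglyMeasurable measurableSet_Ico⟩

theorem hasDerivAt_integral_of_continuousOn
    (hP : ContinuousOn (fun z : ℝ × ℝ => P z.1 z.2) (univ ×ˢ Ico 0 T))
    (hP' : ContinuousOn (fun z : ℝ × ℝ => P' z.1 z.2) (univ ×ˢ Ico 0 T))
    (hd : ∀ θ, ∀ t ∈ Ioo 0 T, HasDerivAt (fun s => P θ s) (P' θ t) t)
    {t : ℝ} (ht : t ∈ Ioo 0 T) (α β : ℝ) :
    HasDerivAt (fun s => ∫ σ in α..β, P σ s) (∫ σ in α..β, P' σ t) t := by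
  -- A compact time interval around `t` inside `(0, T)` makes `P'` bounded, and the bound dominates.
  obtain ⟨u, hu₀, hu⟩ := exists_between ht.1
  obtain ⟨w, hw, hw₀⟩ := exists_between ht.2
  have hsub : Icc u w ⊆ Ico 0 T := fun s hs => ⟨hu₀.le.trans hs.1, hs.2.trans_lt hw₀⟩
  have hcomp : IsCompact (uIcc α β ×ˢ Icc u w) := isCompact_uIcc.prod isCompact_Icc
  obtain ⟨M, hM⟩ := hcomp.exists_bound_of_continuousOn
    (hP'.mono (prod_mono (subset_univ _) hsub))
  have hnhds : Ioo u w ∈ 𝓝 t := Ioo_mem_nhds hu hw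
  refine (intervalIntegral.hasDerivAt_integral_of_dominated_loc_of_deriv_le
    (F := fun s σ => P σ s) (F' := fun s σ => P' σ s) (bound := fun _ => M) hnhds
    ?_ ?_ ?_ ?_ ?_ ?_).2
  · filter_upwards [hnhds] with s hs
    exact (continuousOn_slice hP (hsub (Ioo_subset_Icc_self hs))).aestronglyMeasurable
  · exact (continuousOn_slice hP ⟨ht.1.le, ht.2⟩).intervalIntegrable _ _
  · exact (continuousOn_slice hP' ⟨ht.1.le, ht.2⟩).aestronglyMeasurable
  · exact Eventually.of_forall fun σ hσ s hs =>
      hM (σ, s) ⟨uIoc_subset_uIcc hσ, Ioo_subset_Icc_self hs⟩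
  · exact intervalIntegrable_const
  · exact Eventually.of_forall fun σ _ s hs =>
      hd σ s ⟨hu₀.trans hs.1, hs.2.trans hw₀⟩

end ParametricIntegrals

/-! ### The normalized flow: speed, radius of curvature, curve and support function -/

/-- A positive solution `U` of `U_t = g U² / b (U'' + U)` on `S¹ × [0, T)`, with `U' = U₁` and
`U'' = U₂`: the Euclidean normal speed (up to the factor `g`) of a convex curve moving by
anisotropic curvature. -/
structure IsSpeedSolution (T : ℝ) (b g : ℝ → ℝ) (U U₁ U₂ : ℝ → ℝ → ℝ) : Prop where
  b_continuous : Continuous b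
  b_periodic : Function.Periodic b (2 * Real.pi)
  b_pos : ∀ θ, 0 < b θ
  g_continuous : ContinuousOn g (Ico 0 T)
  g_pos : ∀ t ∈ Ico 0 T, 0 < g t
  periodic : ∀ t ∈ Ico 0 T, Function.Periodic (fun θ => U θ t) (2 * Real.pi)
  hasDerivAt_space : ∀ t ∈ Ico 0 T, ∀ θ, HasDerivAt (fun φ => U φ t) (U₁ θ t) θ
  hasDerivAt_space₁ : ∀ t ∈ Ico 0 T, ∀ θ, HasDerivAt (fun φ => U₁ φ t) (U₂ θ t) θ
  continuousOn : ContinuousOn (fun z : ℝ × ℝ => U z.1 z.2) (univ ×ˢ Ico 0 T)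
  continuousOn₁ : ContinuousOn (fun z : ℝ × ℝ => U₁ z.1 z.2) (univ ×ˢ Ico 0 T)
  continuousOn₂ : ContinuousOn (fun z : ℝ × ℝ => U₂ z.1 z.2) (univ ×ˢ Ico 0 T)
  evolution : ∀ θ, ∀ t ∈ Ioo 0 T,
    HasDerivAt (fun s => U θ s) (g t * (U θ t ^ 2 / b θ) * (U₂ θ t + U θ t)) t
  initial_pos : ∀ θ, 0 < U θ 0

/-- Euclidean radius of curvature. -/
def radius (b : ℝ → ℝ) (U : ℝ → ℝ → ℝ) (θ t : ℝ) : ℝ := b θ / U θ t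

/-- First coordinate of the evolving curve. -/
def curveX (b g : ℝ → ℝ) (U : ℝ → ℝ → ℝ) (θ t : ℝ) : ℝ :=
  -(∫ σ in (0 : ℝ)..θ, radius b U σ t * Real.sin σ) - ∫ s in (0 : ℝ)..t, g s * U 0 s

/-- Second coordinate of the evolving curve. -/
def curveY (b g : ℝ → ℝ) (U U₁ : ℝ → ℝ → ℝ) (θ t : ℝ) : ℝ :=
  (∫ σ in (0 : ℝ)..θ, radius b U σ t * Real.cos σ) - ∫ s in (0 : ℝ)..t, g s * U₁ 0 s

/-- Euclidean support function of the evolving curve. -/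
def support (b g : ℝ → ℝ) (U U₁ : ℝ → ℝ → ℝ) (θ t : ℝ) : ℝ :=
  curveX b g U θ t * Real.cos θ + curveY b g U U₁ θ t * Real.sin θ

/-- Spatial derivative of the Euclidean support function. -/
def support₁ (b g : ℝ → ℝ) (U U₁ : ℝ → ℝ → ℝ) (θ t : ℝ) : ℝ :=
  -curveX b g U θ t * Real.sin θ + curveY b g U U₁ θ t * Real.cos θ

namespace IsSpeedSolution

variable {T : ℝ} {b g : ℝ → ℝ} {U U₁ U₂ : ℝ → ℝ → ℝ}

theorem periodic₁ (h : IsSpeedSolution T b g U U₁ U₂) {t : ℝ} (ht : t ∈ Ico 0 T) :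
    Function.Periodic (fun θ => U₁ θ t) (2 * Real.pi) := by
  intro θ
  have e := h.hasDerivAt_space t ht (θ + 2 * Real.pi)
  have e' := e.comp_add_const θ (2 * Real.pi)
  exact (e'.congr_of_eventuallyEq
    (Eventually.of_forall fun φ => (h.periodic t ht φ).symm)).unique (h.hasDerivAt_space t ht θ)

theorem continuousOn_time (h : IsSpeedSolution T b g U U₁ U₂) (θ : ℝ) :
    ContinuousOn (fun t => U θ t) (Ico 0 T) :=
  h.continuousOn.comp (f := fun t => (θ, t)) (by fun_prop) (fun _ ht => ⟨mem_univ _, ht⟩)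

theorem continuousOn_time₁ (h : IsSpeedSolution T b g U U₁ U₂) (θ : ℝ) :
    ContinuousOn (fun t => U₁ θ t) (Ico 0 T) :=
  h.continuousOn₁.comp (f := fun t => (θ, t)) (by fun_prop) (fun _ ht => ⟨mem_univ _, ht⟩)

/-- The barrier `m - ε (1 + s)`, with `m` the initial minimum, cannot be touched from above: at a
contact `U > 0` and `U'' ≥ 0`, so `U` increases while the barrier decreases. -/
theorem pos (h : IsSpeedSolution T b g U U₁ U₂) (θ : ℝ) {t : ℝ} (ht : t ∈ Ico 0 T) :
    0 < U θ t := by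
  have hT : 0 < T := ht.1.trans_lt ht.2
  have h0 : (0 : ℝ) ∈ Ico 0 T := ⟨le_rfl, hT⟩
  obtain ⟨θ₀, hθ₀⟩ := exists_forall_le_of_periodic (continuousOn_slice h.continuousOn h0).neg
    (fun θ => by simp [h.periodic 0 h0 θ])
  set m := U θ₀ 0 with hm
  have hmpos : 0 < m := h.initial_pos θ₀
  -- Chosen so that the barrier stays at least `m / 2` up to time `T`.
  set ε := m / (2 * (1 + T)) with hε
  have hεpos : 0 < ε := by positivity
  have hεm : ε * (1 + T) = m / 2 := by rw [hε]; field_simp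
  have hsub : Icc 0 t ⊆ Ico 0 T := fun s hs => ⟨hs.1, hs.2.trans_lt ht.2⟩
  have key := neg_of_deriv_time_neg_at_contact (t₁ := t)
    (v := fun θ s => m - ε * (1 + s) - U θ s) (v₁ := fun θ s => -U₁ θ s)
    (v₂ := fun θ s => -U₂ θ s)
    (vt := fun θ s => -ε - g s * (U θ s ^ 2 / b θ) * (U₂ θ s + U θ s))
    (ContinuousOn.sub (by fun_prop) (h.continuousOn.mono (prod_mono le_rfl hsub)))
    (fun s hs θ => by simp [h.periodic s (hsub hs) θ])
    (fun θ => by have := neg_le_neg_iff.1 (hθ₀ θ); linarith)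
    (fun s hs θ => by
      simpa using (h.hasDerivAt_space s (hsub ⟨hs.1.le, hs.2⟩) θ).const_sub (m - ε * (1 + s)))
    (fun s hs θ => (h.hasDerivAt_space₁ s (hsub ⟨hs.1.le, hs.2⟩) θ).neg)
    (fun s hs θ => by
      have e := (((hasDerivAt_id s).const_add 1).const_mul ε).const_sub m
      exact (e.sub (h.evolution θ s ⟨hs.1, hs.2.trans_lt ht.2⟩)).congr_deriv (by ring))
    (fun s hs θ hz _ h2 => by
      have hsT : s < T := hs.2.trans_lt ht.2
      have hU : 0 < U θ s := by nlinarith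
      have hg := h.g_pos s ⟨hs.1.le, hsT⟩
      have hb := h.b_pos θ
      have hsum : 0 < U₂ θ s + U θ s := by linarith
      have : 0 < g s * (U θ s ^ 2 / b θ) * (U₂ θ s + U θ s) := by positivity
      linarith)
    θ t ⟨ht.1, le_rfl⟩
  nlinarith [ht.2]

theorem continuousOn_radius (h : IsSpeedSolution T b g U U₁ U₂) :
    ContinuousOn (fun z : ℝ × ℝ => radius b U z.1 z.2) (univ ×ˢ Ico 0 T) :=
  ContinuousOn.div (h.b_continuous.comp continuous_fst).continuousOn h.continuousOn
    fun z hz => (h.pos z.1 hz.2).ne'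

theorem radius_pos (h : IsSpeedSolution T b g U U₁ U₂) (θ : ℝ) {t : ℝ} (ht : t ∈ Ico 0 T) :
    0 < radius b U θ t := div_pos (h.b_pos θ) (h.pos θ ht)

theorem radius_continuous (h : IsSpeedSolution T b g U U₁ U₂) {t : ℝ} (ht : t ∈ Ico 0 T) :
    Continuous fun θ => radius b U θ t := continuousOn_slice h.continuousOn_radius ht

theorem radius_periodic (h : IsSpeedSolution T b g U U₁ U₂) {t : ℝ} (ht : t ∈ Ico 0 T) :
    Function.Periodic (fun θ => radius b U θ t) (2 * Real.pi) := fun θ => by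
  have := h.periodic t ht θ
  simp only at this
  simp [radius, h.b_periodic θ, this]

/-- In `-b U_t / U²` the factor `U² / b` cancels, so the radius evolves linearly in `U`; the motion
of the curve can then be integrated explicitly. -/
theorem hasDerivAt_radius_time (h : IsSpeedSolution T b g U U₁ U₂) (θ : ℝ) {t : ℝ}
    (ht : t ∈ Ioo 0 T) :
    HasDerivAt (fun s => radius b U θ s) (-(g t * (U₂ θ t + U θ t))) t := by
  have hU := h.pos θ ⟨ht.1.le, ht.2⟩
  have hb := h.b_pos θ
  refine ((hasDerivAt_const t (b θ)).div (h.evolution θ t ht) hU.ne').congr_deriv ?_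
  field_simp
  ring

theorem hasDerivAt_curveX_space (h : IsSpeedSolution T b g U U₁ U₂) (θ : ℝ) {t : ℝ}
    (ht : t ∈ Ico 0 T) :
    HasDerivAt (fun φ => curveX b g U φ t) (-(radius b U θ t * Real.sin θ)) θ :=
  (((h.radius_continuous ht).mul Real.continuous_sin).integral_hasStrictDerivAt 0
    θ).hasDerivAt.neg.sub_const _

theorem hasDerivAt_curveY_space (h : IsSpeedSolution T b g U U₁ U₂) (θ : ℝ) {t : ℝ}
    (ht : t ∈ Ico 0 T) :
    HasDerivAt (fun φ => curveY b g U U₁ φ t) (radius b U θ t * Real.cos θ) θ :=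
  (((h.radius_continuous ht).mul Real.continuous_cos).integral_hasStrictDerivAt 0
    θ).hasDerivAt.sub_const _

theorem continuousOn_curveX (h : IsSpeedSolution T b g U U₁ U₂) :
    ContinuousOn (fun z : ℝ × ℝ => curveX b g U z.1 z.2) (univ ×ˢ Ico 0 T) := by
  refine (continuousOn_integral_space (P := fun σ t => radius b U σ t * Real.sin σ)
    (h.continuousOn_radius.mul (by fun_prop))).neg.sub ?_
  exact (continuousOn_integral_time (h.g_continuous.mul (h.continuousOn_time 0))).comp
    continuousOn_snd fun z hz => hz.2

theorem continuousOn_curveY (h : IsSpeedSolution T b g U U₁ U₂) :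
    ContinuousOn (fun z : ℝ × ℝ => curveY b g U U₁ z.1 z.2) (univ ×ˢ Ico 0 T) := by
  refine (continuousOn_integral_space (P := fun σ t => radius b U σ t * Real.cos σ)
    (h.continuousOn_radius.mul (by fun_prop))).sub ?_
  exact (continuousOn_integral_time (h.g_continuous.mul (h.continuousOn_time₁ 0))).comp
    continuousOn_snd fun z hz => hz.2

theorem continuousOn_support (h : IsSpeedSolution T b g U U₁ U₂) :
    ContinuousOn (fun z : ℝ × ℝ => support b g U U₁ z.1 z.2) (univ ×ˢ Ico 0 T) :=
  (h.continuousOn_curveX.mul (by fun_prop)).add (h.continuousOn_curveY.mul (by fun_prop))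

theorem hasDerivAt_integral_radius_mul (h : IsSpeedSolution T b g U U₁ U₂) {w : ℝ → ℝ}
    (hw : Continuous w) (θ : ℝ) {t : ℝ} (ht : t ∈ Ioo 0 T) :
    HasDerivAt (fun s => ∫ σ in (0 : ℝ)..θ, radius b U σ s * w σ)
      (-g t * ∫ σ in (0 : ℝ)..θ, (U₂ σ t + U σ t) * w σ) t := by
  have hg : ContinuousOn (fun z : ℝ × ℝ => g z.2) (univ ×ˢ Ico 0 T) :=
    h.g_continuous.comp continuousOn_snd fun z hz => hz.2
  have hw' : ContinuousOn (fun z : ℝ × ℝ => w z.1) (univ ×ˢ Ico 0 T) :=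
    (hw.comp continuous_fst).continuousOn
  refine (hasDerivAt_integral_of_continuousOn (P := fun σ s => radius b U σ s * w σ)
    (P' := fun σ s => -(g s * (U₂ σ s + U σ s)) * w σ) (h.continuousOn_radius.mul hw')
    ((hg.mul (h.continuousOn₂.add h.continuousOn)).neg.mul hw')
    (fun θ t ht => (h.hasDerivAt_radius_time θ ht).mul_const _) ht 0 θ).congr_deriv ?_
  rw [← intervalIntegral.integral_const_mul]
  exact intervalIntegral.integral_congr fun σ _ => by ring

/-- If `w'' + w = 0`, then `(U'' + U) w = (U' w - U w')'`; here `w = sin`, and below `w = cos`. -/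
theorem integral_speed_mul_sin (h : IsSpeedSolution T b g U U₁ U₂) (θ : ℝ) {t : ℝ}
    (ht : t ∈ Ico 0 T) : ∫ σ in (0 : ℝ)..θ, (U₂ σ t + U σ t) * Real.sin σ =
      U₁ θ t * Real.sin θ - U θ t * Real.cos θ + U 0 t := by
  rw [intervalIntegral.integral_eq_sub_of_hasDerivAt
    (f := fun σ => U₁ σ t * Real.sin σ - U σ t * Real.cos σ)]
  · simp
  · intro σ _
    exact (((h.hasDerivAt_space₁ t ht σ).mul (Real.hasDerivAt_sin σ)).sub
      ((h.hasDerivAt_space t ht σ).mul (Real.hasDerivAt_cos σ))).congr_deriv (by ring)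
  · exact (((continuousOn_slice h.continuousOn₂ ht).add
      (continuousOn_slice h.continuousOn ht)).mul Real.continuous_sin).intervalIntegrable _ _

theorem integral_speed_mul_cos (h : IsSpeedSolution T b g U U₁ U₂) (θ : ℝ) {t : ℝ}
    (ht : t ∈ Ico 0 T) : ∫ σ in (0 : ℝ)..θ, (U₂ σ t + U σ t) * Real.cos σ =
      U₁ θ t * Real.cos θ + U θ t * Real.sin θ - U₁ 0 t := by
  rw [intervalIntegral.integral_eq_sub_of_hasDerivAt
    (f := fun σ => U₁ σ t * Real.cos σ + U σ t * Real.sin σ)]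
  · simp
  · intro σ _
    exact (((h.hasDerivAt_space₁ t ht σ).mul (Real.hasDerivAt_cos σ)).add
      ((h.hasDerivAt_space t ht σ).mul (Real.hasDerivAt_sin σ))).congr_deriv (by ring)
  · exact (((continuousOn_slice h.continuousOn₂ ht).add
      (continuousOn_slice h.continuousOn ht)).mul Real.continuous_cos).intervalIntegrable _ _

/-- The time integrals in `curveX` and `curveY` cancel the boundary terms at `θ = 0`, leaving pure
inward normal speed `g U` after projection on the normal. -/
theorem hasDerivAt_support_time (h : IsSpeedSolution T b g U U₁ U₂) (θ : ℝ) {t : ℝ}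
    (ht : t ∈ Ioo 0 T) :
    HasDerivAt (fun s => support b g U U₁ θ s) (-(g t * U θ t)) t := by
  have ht' : t ∈ Ico 0 T := ⟨ht.1.le, ht.2⟩
  have hX := (h.hasDerivAt_integral_radius_mul Real.continuous_sin θ ht).neg.sub
    (hasDerivAt_integral_time (h.g_continuous.mul (h.continuousOn_time 0)) ht)
  have hY := (h.hasDerivAt_integral_radius_mul Real.continuous_cos θ ht).sub
    (hasDerivAt_integral_time (h.g_continuous.mul (h.continuousOn_time₁ 0)) ht)
  rw [h.integral_speed_mul_sin θ ht'] at hX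
  rw [h.integral_speed_mul_cos θ ht'] at hY
  refine ((hX.mul_const (Real.cos θ)).add (hY.mul_const (Real.sin θ))).congr_deriv ?_
  simp only [Pi.mul_apply]
  linear_combination (-(g t * U θ t)) * Real.sin_sq_add_cos_sq θ

/-- The derivative of the curve is tangential, so only the normal vector contributes. -/
theorem hasDerivAt_support_space (h : IsSpeedSolution T b g U U₁ U₂) (θ : ℝ) {t : ℝ}
    (ht : t ∈ Ico 0 T) :
    HasDerivAt (fun φ => support b g U U₁ φ t) (support₁ b g U U₁ θ t) θ :=
  (((h.hasDerivAt_curveX_space θ ht).mul (Real.hasDerivAt_cos θ)).add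
    ((h.hasDerivAt_curveY_space θ ht).mul (Real.hasDerivAt_sin θ))).congr_deriv
    (by simp only [support₁]; ring)

theorem hasDerivAt_support₁_space (h : IsSpeedSolution T b g U U₁ U₂) (θ : ℝ) {t : ℝ}
    (ht : t ∈ Ico 0 T) :
    HasDerivAt (fun φ => support₁ b g U U₁ φ t)
      (radius b U θ t - support b g U U₁ θ t) θ :=
  (((h.hasDerivAt_curveX_space θ ht).neg.mul (Real.hasDerivAt_sin θ)).add
    ((h.hasDerivAt_curveY_space θ ht).mul (Real.hasDerivAt_cos θ))).congr_deriv
    (by simp only [support, Pi.neg_apply]; linear_combination radius b U θ t * Real.sin_sq_add_cos_sq θ)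

/-- Positive speed moves every supporting line inwards. This serves twice: to bound the length, and
to keep an inscribed disc inside all earlier curves. -/
theorem support_antitoneOn (h : IsSpeedSolution T b g U U₁ U₂) (θ : ℝ) :
    AntitoneOn (fun t => support b g U U₁ θ t) (Ico 0 T) := by
  refine antitoneOn_of_hasDerivWithinAt_nonpos (f' := fun t => -(g t * U θ t)) (convex_Ico _ _)
    (h.continuousOn_support.comp (f := fun t => (θ, t)) (by fun_prop)
      (fun _ ht => ⟨mem_univ _, ht⟩)) ?_ ?_ <;> rw [interior_Ico]
  · exact fun t ht => (h.hasDerivAt_support_time θ ht).hasDerivWithinAt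
  · intro t ht
    have ht' : t ∈ Ico 0 T := ⟨ht.1.le, ht.2⟩
    have := mul_pos (h.g_pos t ht') (h.pos θ ht')
    linarith

/-- The time derivative is `-g ∫ (U'' + U) w = 0`, so closedness of the initial curve persists. -/
theorem integral_radius_mul_eq_zero (h : IsSpeedSolution T b g U U₁ U₂) {w : ℝ → ℝ}
    (hw : Continuous w)
    (hw0 : ∀ t ∈ Ioo 0 T, ∫ σ in (0 : ℝ)..(2 * Real.pi), (U₂ σ t + U σ t) * w σ = 0)
    (hinit : ∫ σ in (0 : ℝ)..(2 * Real.pi), radius b U σ 0 * w σ = 0) {t : ℝ}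
    (ht : t ∈ Ico 0 T) : ∫ σ in (0 : ℝ)..(2 * Real.pi), radius b U σ t * w σ = 0 := by
  have hw' : ContinuousOn (fun z : ℝ × ℝ => w z.1) (univ ×ˢ Ico 0 T) :=
    (hw.comp continuous_fst).continuousOn
  have hc : ContinuousOn (fun t => ∫ σ in (0 : ℝ)..(2 * Real.pi), radius b U σ t * w σ)
      (Ico 0 T) :=
    (continuousOn_integral_space (P := fun σ t => radius b U σ t * w σ)
      (h.continuousOn_radius.mul hw')).comp (f := fun t => (2 * Real.pi, t)) (by fun_prop)
      (fun _ ht => ⟨mem_univ _, ht⟩)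
  have hd : ∀ s ∈ interior (Ico 0 T), HasDerivWithinAt
      (fun t => ∫ σ in (0 : ℝ)..(2 * Real.pi), radius b U σ t * w σ) 0 (interior (Ico 0 T)) s := by
    rw [interior_Ico]
    intro s hs
    simpa [hw0 s hs] using
      (h.hasDerivAt_integral_radius_mul hw (2 * Real.pi) hs).hasDerivWithinAt (s := Ioo 0 T)
  have h0 : (0 : ℝ) ∈ Ico 0 T := ⟨le_rfl, ht.1.trans_lt ht.2⟩
  refine Eq.trans ?_ hinit
  exact le_antisymm
    (antitoneOn_of_hasDerivWithinAt_nonpos (convex_Ico _ _) hc hd (fun _ _ => le_rfl) h0 ht ht.1)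
    (monotoneOn_of_hasDerivWithinAt_nonneg (convex_Ico _ _) hc hd (fun _ _ => le_rfl) h0 ht ht.1)

theorem integral_radius_mul_sin_eq_zero (h : IsSpeedSolution T b g U U₁ U₂)
    (hinit : ∫ σ in (0 : ℝ)..(2 * Real.pi), radius b U σ 0 * Real.sin σ = 0) {t : ℝ}
    (ht : t ∈ Ico 0 T) : ∫ σ in (0 : ℝ)..(2 * Real.pi), radius b U σ t * Real.sin σ = 0 := by
  refine h.integral_radius_mul_eq_zero Real.continuous_sin (fun s hs => ?_) hinit ht
  have hs' : s ∈ Ico 0 T := ⟨hs.1.le, hs.2⟩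
  have e : U (2 * Real.pi) s = U 0 s := (h.periodic s hs').eq
  rw [h.integral_speed_mul_sin _ hs', e]
  simp

theorem integral_radius_mul_cos_eq_zero (h : IsSpeedSolution T b g U U₁ U₂)
    (hinit : ∫ σ in (0 : ℝ)..(2 * Real.pi), radius b U σ 0 * Real.cos σ = 0) {t : ℝ}
    (ht : t ∈ Ico 0 T) : ∫ σ in (0 : ℝ)..(2 * Real.pi), radius b U σ t * Real.cos σ = 0 := by
  refine h.integral_radius_mul_eq_zero Real.continuous_cos (fun s hs => ?_) hinit ht
  have hs' : s ∈ Ico 0 T := ⟨hs.1.le, hs.2⟩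
  have e : U₁ (2 * Real.pi) s = U₁ 0 s := (h.periodic₁ hs').eq
  rw [h.integral_speed_mul_cos _ hs', e]
  simp

theorem curveX_periodic (h : IsSpeedSolution T b g U U₁ U₂)
    (hinit : ∫ σ in (0 : ℝ)..(2 * Real.pi), radius b U σ 0 * Real.sin σ = 0) {t : ℝ}
    (ht : t ∈ Ico 0 T) : Function.Periodic (fun θ => curveX b g U θ t) (2 * Real.pi) := by
  intro θ
  have hc : Continuous fun σ => radius b U σ t * Real.sin σ :=
    (h.radius_continuous ht).mul Real.continuous_sin
  have hp : Function.Periodic (fun σ => radius b U σ t * Real.sin σ) (2 * Real.pi) :=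
    (h.radius_periodic ht).mul Real.sin_periodic
  have e := hp.intervalIntegral_add_eq θ 0
  rw [zero_add, h.integral_radius_mul_sin_eq_zero hinit ht] at e
  simp only [curveX]
  rw [← intervalIntegral.integral_add_adjacent_intervals (hc.intervalIntegrable 0 θ)
    (hc.intervalIntegrable θ (θ + 2 * Real.pi)), e, add_zero]

theorem curveY_periodic (h : IsSpeedSolution T b g U U₁ U₂)
    (hinit : ∫ σ in (0 : ℝ)..(2 * Real.pi), radius b U σ 0 * Real.cos σ = 0) {t : ℝ}
    (ht : t ∈ Ico 0 T) : Function.Periodic (fun θ => curveY b g U U₁ θ t) (2 * Real.pi) := by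
  intro θ
  have hc : Continuous fun σ => radius b U σ t * Real.cos σ :=
    (h.radius_continuous ht).mul Real.continuous_cos
  have hp : Function.Periodic (fun σ => radius b U σ t * Real.cos σ) (2 * Real.pi) :=
    (h.radius_periodic ht).mul Real.cos_periodic
  have e := hp.intervalIntegral_add_eq θ 0
  rw [zero_add, h.integral_radius_mul_cos_eq_zero hinit ht] at e
  simp only [curveY]
  rw [← intervalIntegral.integral_add_adjacent_intervals (hc.intervalIntegrable 0 θ)
    (hc.intervalIntegrable θ (θ + 2 * Real.pi)), e, add_zero]

end IsSpeedSolution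

/-! ### Closed convex curves: supporting lines, area and length -/

section ConvexCurve

variable {r X Y : ℝ → ℝ}

/-- The distance from the point of a convex curve with normal angle `φ` to its supporting line with
normal angle `θ` is nonnegative and at most the length of the curve. -/
theorem supporting_line_dist_mem_Icc (hr : Continuous r) (hr0 : ∀ θ, 0 ≤ r θ)
    (hrp : Function.Periodic r (2 * Real.pi))
    (hX : ∀ θ, HasDerivAt X (-(r θ * Real.sin θ)) θ) (hY : ∀ θ, HasDerivAt Y (r θ * Real.cos θ) θ)
    (hXp : Function.Periodic X (2 * Real.pi)) (hYp : Function.Periodic Y (2 * Real.pi))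
    (θ φ : ℝ) :
    (X θ - X φ) * Real.cos θ + (Y θ - Y φ) * Real.sin θ ∈
      Icc 0 (∫ σ in (0 : ℝ)..(2 * Real.pi), r σ) := by
  set y : ℝ → ℝ := fun φ => (X θ - X φ) * Real.cos θ + (Y θ - Y φ) * Real.sin θ with hy
  have hd : ∀ φ, HasDerivAt y (r φ * Real.sin (φ - θ)) φ := fun φ =>
    ((((hX φ).const_sub _).mul_const _).add (((hY φ).const_sub _).mul_const _)).congr_deriv
      (by rw [Real.sin_sub]; ring)
  have hc : Continuous y := continuous_iff_continuousAt.2 fun φ => (hd φ).continuousAt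
  have hyp : Function.Periodic y (2 * Real.pi) := fun φ => by simp [hy, hXp φ, hYp φ]
  have hyθ : y θ = 0 := by simp [hy]
  have hpi := Real.pi_pos
  -- The sign of `sin (φ - θ)` makes `y` minimal at `φ = θ`, where it vanishes.
  have hright : MonotoneOn y (Icc θ (θ + Real.pi)) := by
    refine monotoneOn_of_hasDerivWithinAt_nonneg (convex_Icc _ _) hc.continuousOn
      (fun φ _ => (hd φ).hasDerivWithinAt) fun φ hφ => ?_
    rw [interior_Icc] at hφ
    exact mul_nonneg (hr0 φ) (Real.sin_nonneg_of_nonneg_of_le_pi (by linarith [hφ.1])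
      (by linarith [hφ.2]))
  have hleft : AntitoneOn y (Icc (θ - Real.pi) θ) := by
    refine antitoneOn_of_hasDerivWithinAt_nonpos (convex_Icc _ _) hc.continuousOn
      (fun φ _ => (hd φ).hasDerivWithinAt) fun φ hφ => ?_
    rw [interior_Icc] at hφ
    exact mul_nonpos_of_nonneg_of_nonpos (hr0 φ) (Real.sin_nonpos_of_nonpos_of_neg_pi_le
      (by linarith [hφ.2]) (by linarith [hφ.1]))
  change y φ ∈ _
  constructor
  · obtain ⟨ψ, hψ, e⟩ := hyp.exists_mem_Ico (by positivity) φ (θ - Real.pi)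
    rw [e, ← hyθ]
    rcases le_total θ ψ with hle | hle
    · exact hright ⟨le_rfl, by linarith⟩ ⟨hle, by linarith [hψ.2]⟩ hle
    · exact hleft ⟨hψ.1, hle⟩ ⟨by linarith, le_rfl⟩ hle
  · obtain ⟨ψ, hψ, e⟩ := hyp.exists_mem_Ico (by positivity) φ θ
    have hc' : Continuous fun σ => r σ * Real.sin (σ - θ) := by fun_prop
    have hint := intervalIntegral.integral_eq_sub_of_hasDerivAt (a := θ) (b := ψ)
      (fun σ _ => hd σ) (hc'.intervalIntegrable _ _)
    rw [hyθ, sub_zero] at hint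
    rw [e, ← hint, ← zero_add (2 * Real.pi), ← hrp.intervalIntegral_add_eq θ 0]
    calc ∫ σ in θ..ψ, r σ * Real.sin (σ - θ) ≤ ∫ σ in θ..ψ, r σ :=
          intervalIntegral.integral_mono_on hψ.1 (hc'.intervalIntegrable _ _)
            (hr.intervalIntegrable _ _)
            fun σ _ => mul_le_of_le_one_right (hr0 σ) (Real.sin_le_one _)
      _ ≤ ∫ σ in θ..(θ + 2 * Real.pi), r σ :=
          intervalIntegral.integral_mono_interval le_rfl hψ.1 hψ.2.le
            (Eventually.of_forall hr0) (hr.intervalIntegrable _ _)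

/-- The area enclosed by a convex curve is at most the integral over the curve of the distance to a
fixed supporting line. -/
theorem area_le_integral_supporting_line_dist (hr : Continuous r) (hr0 : ∀ θ, 0 ≤ r θ)
    (hrp : Function.Periodic r (2 * Real.pi))
    (hX : ∀ θ, HasDerivAt X (-(r θ * Real.sin θ)) θ) (hY : ∀ θ, HasDerivAt Y (r θ * Real.cos θ) θ)
    (hXp : Function.Periodic X (2 * Real.pi)) (hYp : Function.Periodic Y (2 * Real.pi))
    (θ : ℝ) :
    1 / 2 * ∫ φ in (0 : ℝ)..(2 * Real.pi), r φ * (X φ * Real.cos φ + Y φ * Real.sin φ) ≤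
      ∫ φ in (0 : ℝ)..(2 * Real.pi),
        ((X θ - X φ) * Real.cos θ + (Y θ - Y φ) * Real.sin θ) * r φ := by
  have hXc : Continuous X := continuous_iff_continuousAt.2 fun φ => (hX φ).continuousAt
  have hYc : Continuous Y := continuous_iff_continuousAt.2 fun φ => (hY φ).continuousAt
  set p : ℝ → ℝ := fun φ => X φ * Real.cos θ + Y φ * Real.sin θ with hp
  set q : ℝ → ℝ := fun φ => -X φ * Real.sin θ + Y φ * Real.cos θ with hq
  set p' : ℝ → ℝ := fun φ => -(r φ * Real.sin (φ - θ)) with hp'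
  set q' : ℝ → ℝ := fun φ => r φ * Real.cos (φ - θ) with hq'
  have hpd : ∀ φ, HasDerivAt p (p' φ) φ := fun φ =>
    (((hX φ).mul_const _).add ((hY φ).mul_const _)).congr_deriv
      (by simp only [hp', Real.sin_sub]; ring)
  have hqd : ∀ φ, HasDerivAt q (q' φ) φ := fun φ =>
    (((hX φ).neg.mul_const _).add ((hY φ).mul_const _)).congr_deriv
      (by simp only [hq', Real.cos_sub]; ring)
  -- In the normal and tangential coordinates `p`, `q` at `θ`, the area is `1/2 ∫ (p q' - q p')`.
  -- Adding the exact derivative of this periodic function, whose integral is zero, turns the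
  -- difference of the two sides into `∫ y r (1 + cos (φ - θ))` with `y = p θ - p φ ≥ 0`.
  have hW : ∀ φ, HasDerivAt (fun φ => p θ * q φ - 1 / 2 * (p φ * q φ))
      (p θ * q' φ - 1 / 2 * (p' φ * q φ + p φ * q' φ)) φ := fun φ =>
    ((hqd φ).const_mul _).sub (((hpd φ).mul (hqd φ)).const_mul _)
  have hpc : Continuous p := by fun_prop
  have hqc : Continuous q := by fun_prop
  have hpc' : Continuous p' := by fun_prop
  have hqc' : Continuous q' := by fun_prop
  have hWint := intervalIntegral.integral_eq_sub_of_hasDerivAt (a := 0) (b := 2 * Real.pi)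
    (fun σ _ => hW σ) (Continuous.intervalIntegrable (by fun_prop) _ _)
  have hq0 : q (2 * Real.pi) = q 0 := by simp [hq, hXp.eq, hYp.eq]
  have hp0 : p (2 * Real.pi) = p 0 := by simp [hp, hXp.eq, hYp.eq]
  rw [hq0, hp0, sub_self] at hWint
  rw [← sub_nonneg, ← intervalIntegral.integral_const_mul, ← intervalIntegral.integral_sub
    (Continuous.intervalIntegrable (by fun_prop) _ _)
    (Continuous.intervalIntegrable (by fun_prop) _ _)]
  refine le_of_le_of_eq ?_ ((congrArg (_ + ·) hWint).trans (add_zero _))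
  rw [← intervalIntegral.integral_add (Continuous.intervalIntegrable (by fun_prop) _ _)
    (Continuous.intervalIntegrable (by fun_prop) _ _)]
  refine intervalIntegral.integral_nonneg (by positivity) fun φ _ => ?_
  have hy := (supporting_line_dist_mem_Icc hr hr0 hrp hX hY hXp hYp θ φ).1
  have hcos : 0 ≤ 1 + Real.cos (φ - θ) := by linarith [Real.neg_one_le_cos (φ - θ)]
  have : 0 ≤ ((X θ - X φ) * Real.cos θ + (Y θ - Y φ) * Real.sin θ) * r φ *
      (1 + Real.cos (φ - θ)) := mul_nonneg (mul_nonneg hy (hr0 φ)) hcos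
  refine this.trans_eq ?_
  have key : p φ * q' φ - q φ * p' φ = r φ * (X φ * Real.cos φ + Y φ * Real.sin φ) := by
    simp only [hp, hq, hp', hq', Real.sin_sub, Real.cos_sub]
    linear_combination
      (r φ * (X φ * Real.cos φ + Y φ * Real.sin φ)) * Real.sin_sq_add_cos_sq θ
  rw [← key]
  simp only [hp, hq']
  ring

/-- With respect to the centroid of the boundary, the support function of a convex curve of length
`L` and enclosed area `A` lies between `A / L` and `L`. -/
theorem exists_center_support_mem_Icc (hr : Continuous r) (hr0 : ∀ θ, 0 < r θ)
    (hrp : Function.Periodic r (2 * Real.pi))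
    (hX : ∀ θ, HasDerivAt X (-(r θ * Real.sin θ)) θ) (hY : ∀ θ, HasDerivAt Y (r θ * Real.cos θ) θ)
    (hXp : Function.Periodic X (2 * Real.pi)) (hYp : Function.Periodic Y (2 * Real.pi)) :
    ∃ x₁ x₂ : ℝ, ∀ θ,
      X θ * Real.cos θ + Y θ * Real.sin θ - (x₁ * Real.cos θ + x₂ * Real.sin θ) ∈
      Icc ((1 / 2 * ∫ φ in (0 : ℝ)..(2 * Real.pi), r φ * (X φ * Real.cos φ + Y φ * Real.sin φ)) /
        ∫ φ in (0 : ℝ)..(2 * Real.pi), r φ) (∫ φ in (0 : ℝ)..(2 * Real.pi), r φ) := by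
  have hXc : Continuous X := continuous_iff_continuousAt.2 fun φ => (hX φ).continuousAt
  have hYc : Continuous Y := continuous_iff_continuousAt.2 fun φ => (hY φ).continuousAt
  set L := ∫ φ in (0 : ℝ)..(2 * Real.pi), r φ with hL
  have hLpos : 0 < L := intervalIntegral.intervalIntegral_pos_of_pos
    (hr.intervalIntegrable _ _) hr0 (by positivity)
  -- Relative to the centroid, the support function at `θ` is the arclength average of the distances
  -- from the curve to the supporting line there; both bounds follow by averaging.
  refine ⟨(∫ φ in (0 : ℝ)..(2 * Real.pi), X φ * r φ) / L,
    (∫ φ in (0 : ℝ)..(2 * Real.pi), Y φ * r φ) / L, fun θ => ?_⟩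
  have e : X θ * Real.cos θ + Y θ * Real.sin θ -
      ((∫ φ in (0 : ℝ)..(2 * Real.pi), X φ * r φ) / L * Real.cos θ +
        (∫ φ in (0 : ℝ)..(2 * Real.pi), Y φ * r φ) / L * Real.sin θ) =
      (∫ φ in (0 : ℝ)..(2 * Real.pi),
        ((X θ - X φ) * Real.cos θ + (Y θ - Y φ) * Real.sin θ) * r φ) / L := by
    have : ∀ φ, ((X θ - X φ) * Real.cos θ + (Y θ - Y φ) * Real.sin θ) * r φ =
      (X θ * Real.cos θ + Y θ * Real.sin θ) * r φ -
        (Real.cos θ * (X φ * r φ) + Real.sin θ * (Y φ * r φ)) := fun φ => by ring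
    simp only [this]
    rw [intervalIntegral.integral_sub (Continuous.intervalIntegrable (by fun_prop) _ _)
      (Continuous.intervalIntegrable (by fun_prop) _ _), intervalIntegral.integral_add
      (Continuous.intervalIntegrable (by fun_prop) _ _)
      (Continuous.intervalIntegrable (by fun_prop) _ _)]
    simp only [intervalIntegral.integral_const_mul, ← hL]
    field_simp
  have hr0' := fun θ => (hr0 θ).le
  rw [e]
  refine ⟨div_le_div_of_nonneg_right
    (area_le_integral_supporting_line_dist hr hr0' hrp hX hY hXp hYp θ) hLpos.le, ?_⟩
  rw [div_le_iff₀ hLpos]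
  conv_rhs => arg 2; rw [hL]
  rw [← intervalIntegral.integral_const_mul]
  exact intervalIntegral.integral_mono_on (by positivity)
    (Continuous.intervalIntegrable (by fun_prop) _ _)
    (Continuous.intervalIntegrable (by fun_prop) _ _) fun φ _ => mul_le_mul_of_nonneg_right
      (supporting_line_dist_mem_Icc hr hr0' hrp hX hY hXp hYp θ φ).2 (hr0' φ)

end ConvexCurve

/-! ### Length monotonicity and the upper bound for the speed -/

namespace IsSpeedSolution

variable {T : ℝ} {b g : ℝ → ℝ} {U U₁ U₂ : ℝ → ℝ → ℝ}

/-- Cauchy's formula for the length. -/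
theorem integral_radius_eq_integral_support (h : IsSpeedSolution T b g U U₁ U₂)
    (hsin : ∫ σ in (0 : ℝ)..(2 * Real.pi), radius b U σ 0 * Real.sin σ = 0)
    (hcos : ∫ σ in (0 : ℝ)..(2 * Real.pi), radius b U σ 0 * Real.cos σ = 0) {t : ℝ}
    (ht : t ∈ Ico 0 T) : ∫ θ in (0 : ℝ)..(2 * Real.pi), radius b U θ t =
      ∫ θ in (0 : ℝ)..(2 * Real.pi), support b g U U₁ θ t := by
  have hr := h.radius_continuous ht
  have hs := continuousOn_slice h.continuousOn_support ht
  -- Since `r - S = S''`, the integral is the increment of `S'` over a period, zero because the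
  -- curve is closed.
  have e := intervalIntegral.integral_eq_sub_of_hasDerivAt (a := 0) (b := 2 * Real.pi)
    (fun θ _ => h.hasDerivAt_support₁_space θ ht) ((hr.sub hs).intervalIntegrable _ _)
  have eX : curveX b g U (2 * Real.pi) t = curveX b g U 0 t := (h.curveX_periodic hsin ht).eq
  have eY : curveY b g U U₁ (2 * Real.pi) t = curveY b g U U₁ 0 t :=
    (h.curveY_periodic hcos ht).eq
  rw [intervalIntegral.integral_sub (hr.intervalIntegrable _ _) (hs.intervalIntegrable _ _)] at e
  simp only [support₁, eX, eY, Real.sin_two_pi, Real.cos_two_pi, Real.sin_zero, Real.cos_zero,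
    sub_self] at e
  linarith

theorem integral_radius_le_initial (h : IsSpeedSolution T b g U U₁ U₂)
    (hsin : ∫ σ in (0 : ℝ)..(2 * Real.pi), radius b U σ 0 * Real.sin σ = 0)
    (hcos : ∫ σ in (0 : ℝ)..(2 * Real.pi), radius b U σ 0 * Real.cos σ = 0) {t : ℝ}
    (ht : t ∈ Ico 0 T) : ∫ θ in (0 : ℝ)..(2 * Real.pi), radius b U θ t ≤
      ∫ θ in (0 : ℝ)..(2 * Real.pi), radius b U θ 0 := by
  have h0 : (0 : ℝ) ∈ Ico 0 T := ⟨le_rfl, ht.1.trans_lt ht.2⟩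
  rw [h.integral_radius_eq_integral_support hsin hcos ht,
    h.integral_radius_eq_integral_support hsin hcos h0]
  exact intervalIntegral.integral_mono_on (by positivity)
    ((continuousOn_slice h.continuousOn_support ht).intervalIntegrable _ _)
    ((continuousOn_slice h.continuousOn_support h0).intervalIntegrable _ _)
    fun θ _ => h.support_antitoneOn θ h0 ht ht.1

theorem support_periodic (h : IsSpeedSolution T b g U U₁ U₂)
    (hsin : ∫ σ in (0 : ℝ)..(2 * Real.pi), radius b U σ 0 * Real.sin σ = 0)
    (hcos : ∫ σ in (0 : ℝ)..(2 * Real.pi), radius b U σ 0 * Real.cos σ = 0) {t : ℝ}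
    (ht : t ∈ Ico 0 T) : Function.Periodic (fun θ => support b g U U₁ θ t) (2 * Real.pi) :=
  ((h.curveX_periodic hsin ht).mul Real.cos_periodic).add
    ((h.curveY_periodic hcos ht).mul Real.sin_periodic)

/-- If the curve contains, up to time `t₁`, the disc of radius `2ρ` about `(x₁, x₂)`, then the
quotient of the speed and the support function minus `ρ` stays below a constant. -/
theorem speed_lt_mul_support (h : IsSpeedSolution T b g U U₁ U₂)
    (hsin : ∫ σ in (0 : ℝ)..(2 * Real.pi), radius b U σ 0 * Real.sin σ = 0)
    (hcos : ∫ σ in (0 : ℝ)..(2 * Real.pi), radius b U σ 0 * Real.cos σ = 0) {t₁ ρ M m B x₁ x₂ : ℝ}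
    (ht₁ : t₁ ∈ Ico 0 T) (hρ : 0 < ρ) (hM : ∀ θ, b θ ≤ M) (hm : ∀ θ, U θ 0 ≤ m)
    (hBm : m < B * ρ) (hBM : 2 * M < B * ρ ^ 2)
    (hx : ∀ θ, 2 * ρ ≤ support b g U U₁ θ t₁ - (x₁ * Real.cos θ + x₂ * Real.sin θ)) (θ : ℝ) :
    U θ t₁ < B * (support b g U U₁ θ t₁ - (x₁ * Real.cos θ + x₂ * Real.sin θ) - ρ) := by
  have hsub : Icc 0 t₁ ⊆ Ico 0 T := fun s hs => ⟨hs.1, hs.2.trans_lt ht₁.2⟩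
  have h0 : (0 : ℝ) ∈ Ico 0 T := ⟨le_rfl, ht₁.1.trans_lt ht₁.2⟩
  have hBpos : 0 < B := by
    have : 0 < B * ρ := ((h.initial_pos 0).trans_le (hm 0)).trans hBm
    exact pos_of_mul_pos_left this hρ.le
  have hxt : ∀ θ, ∀ t ∈ Icc 0 t₁,
      2 * ρ ≤ support b g U U₁ θ t - (x₁ * Real.cos θ + x₂ * Real.sin θ) := fun θ t ht => by
    have : support b g U U₁ θ t₁ ≤ support b g U U₁ θ t :=
      h.support_antitoneOn θ (hsub ht) ht₁ ht.2
    linarith [hx θ]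
  have key := neg_of_deriv_time_neg_at_contact (t₁ := t₁)
    (v := fun θ t => U θ t -
      B * (support b g U U₁ θ t - (x₁ * Real.cos θ + x₂ * Real.sin θ) - ρ))
    (v₁ := fun θ t => U₁ θ t -
      B * (support₁ b g U U₁ θ t - (x₁ * -Real.sin θ + x₂ * Real.cos θ)))
    (v₂ := fun θ t => U₂ θ t -
      B * (radius b U θ t - support b g U U₁ θ t - (x₁ * -Real.cos θ + x₂ * -Real.sin θ)))
    (vt := fun θ t => g t * (U θ t ^ 2 / b θ) * (U₂ θ t + U θ t) - B * -(g t * U θ t))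
    ?_ ?_ ?_ ?_ ?_ ?_ ?_ θ t₁ ⟨ht₁.1, le_rfl⟩
  · linarith
  · have hs := h.continuousOn_support.mono (prod_mono (subset_univ univ) hsub)
    exact (h.continuousOn.mono (prod_mono (subset_univ univ) hsub)).sub
      (continuousOn_const.mul ((hs.sub (by fun_prop)).sub continuousOn_const))
  · intro t ht θ
    have e₁ := h.periodic t (hsub ht) θ
    have e₂ := h.support_periodic hsin hcos (hsub ht) θ
    simp only at e₁ e₂ ⊢
    rw [e₁, e₂, Real.cos_add_two_pi, Real.sin_add_two_pi]
  · intro θ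
    have h2 := hxt θ 0 ⟨le_rfl, ht₁.1⟩
    have : B * ρ ≤ B * (support b g U U₁ θ 0 - (x₁ * Real.cos θ + x₂ * Real.sin θ) - ρ) :=
      mul_le_mul_of_nonneg_left (by linarith) hBpos.le
    linarith [hm θ]
  · intro t ht θ
    have ht' := hsub ⟨ht.1.le, ht.2⟩
    exact (h.hasDerivAt_space t ht' θ).sub ((((h.hasDerivAt_support_space θ ht').sub
      (((Real.hasDerivAt_cos θ).const_mul _).add
        ((Real.hasDerivAt_sin θ).const_mul _))).sub_const ρ).const_mul B)
  · intro t ht θ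
    have ht' := hsub ⟨ht.1.le, ht.2⟩
    exact (h.hasDerivAt_space₁ t ht' θ).sub (((h.hasDerivAt_support₁_space θ ht').sub
      (((Real.hasDerivAt_sin θ).neg.const_mul _).add
        ((Real.hasDerivAt_cos θ).const_mul _))).const_mul B)
  · intro t ht θ
    have ht' : t ∈ Ioo 0 T := ⟨ht.1, ht.2.trans_lt ht₁.2⟩
    exact (h.evolution θ t ht').sub
      ((((h.hasDerivAt_support_time θ ht').sub_const _).sub_const ρ).const_mul B)
  · intro t ht θ hz _ h2
    have ht' := hsub ⟨ht.1.le, ht.2⟩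
    have hS := hxt θ t ⟨ht.1.le, ht.2⟩
    have hU := h.pos θ ht'
    have hb := h.b_pos θ
    have hg := h.g_pos t ht'
    -- Adding the contact equality to the second-order condition cancels the support function.
    have hsum : U₂ θ t + U θ t ≤ B * (b θ / U θ t - ρ) := by
      simp only [radius] at h2
      linarith
    have hUlow : B * ρ ≤ U θ t := by
      have : B * ρ ≤ B * (support b g U U₁ θ t - (x₁ * Real.cos θ + x₂ * Real.sin θ) - ρ) :=
        mul_le_mul_of_nonneg_left (by linarith) hBpos.le
      linarith
    -- The disc of radius `2ρ` gives `U ≥ B ρ` at a contact, hence `ρ U ≥ B ρ² > 2M ≥ 2b`.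
    have hlarge : 2 * b θ < ρ * U θ t := by nlinarith [hM θ]
    have hle : g t * (U θ t ^ 2 / b θ) * (U₂ θ t + U θ t) ≤
        g t * (U θ t ^ 2 / b θ) * (B * (b θ / U θ t - ρ)) :=
      mul_le_mul_of_nonneg_left hsum (by positivity)
    have e : g t * (U θ t ^ 2 / b θ) * (B * (b θ / U θ t - ρ)) - B * -(g t * U θ t) =
        g t * U θ t * B / b θ * (2 * b θ - ρ * U θ t) := by
      field_simp
      ring
    have : g t * U θ t * B / b θ * (2 * b θ - ρ * U θ t) < 0 :=
      mul_neg_of_pos_of_neg (by positivity) (by linarith)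
    linarith

/-- The speed is bounded as long as the enclosed area is bounded away from zero. -/
theorem exists_bound (h : IsSpeedSolution T b g U U₁ U₂)
    (hsin : ∫ σ in (0 : ℝ)..(2 * Real.pi), radius b U σ 0 * Real.sin σ = 0)
    (hcos : ∫ σ in (0 : ℝ)..(2 * Real.pi), radius b U σ 0 * Real.cos σ = 0) {c : ℝ} (hc : 0 < c)
    (harea : ∀ t ∈ Ico 0 T, c ≤
      1 / 2 * ∫ θ in (0 : ℝ)..(2 * Real.pi), radius b U θ t * support b g U U₁ θ t) :
    ∃ C, ∀ θ, ∀ t ∈ Ico 0 T, U θ t ≤ C := by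
  rcases le_or_gt T 0 with hT | hT
  · exact ⟨0, fun θ t ht => absurd (ht.1.trans_lt ht.2) hT.not_gt⟩
  have h0 : (0 : ℝ) ∈ Ico 0 T := ⟨le_rfl, hT⟩
  have hlen : ∀ t ∈ Ico 0 T, 0 < ∫ θ in (0 : ℝ)..(2 * Real.pi), radius b U θ t := fun t ht =>
    intervalIntegral.intervalIntegral_pos_of_pos ((h.radius_continuous ht).intervalIntegrable _ _)
      (fun θ => h.radius_pos θ ht) (by positivity)
  set L := ∫ θ in (0 : ℝ)..(2 * Real.pi), radius b U θ 0 with hL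
  have hLpos : 0 < L := hlen 0 h0
  obtain ⟨θM, hM⟩ := exists_forall_le_of_periodic h.b_continuous h.b_periodic
  obtain ⟨θm, hm⟩ := exists_forall_le_of_periodic (continuousOn_slice h.continuousOn h0)
    (h.periodic 0 h0)
  have hMpos := h.b_pos θM
  have hmpos := h.initial_pos θm
  -- Area at least `c` and length at most `L` give an inscribed disc of radius `c / L = 2ρ`.
  set ρ := c / (2 * L) with hρ
  have hρpos : 0 < ρ := by positivity
  -- The first term secures the initial inequality, the second the contact inequality, and the `1`
  -- strictness.
  set B := U θm 0 / ρ + 2 * b θM / ρ ^ 2 + 1 with hB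
  have hBpos : 0 < B := by positivity
  have hB₁ : U θm 0 < B * ρ := by
    have : B * ρ = U θm 0 + 2 * b θM / ρ + ρ := by rw [hB]; field_simp
    have : 0 < 2 * b θM / ρ := by positivity
    linarith
  have hB₂ : 2 * b θM < B * ρ ^ 2 := by
    have : B * ρ ^ 2 = U θm 0 * ρ + 2 * b θM + ρ ^ 2 := by rw [hB]; field_simp
    have : 0 < U θm 0 * ρ + ρ ^ 2 := by positivity
    linarith
  refine ⟨B * L, fun θ t ht => ?_⟩
  -- The centre varies with `t`, but `ρ` and `B` do not, so the final bound is uniform.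
  obtain ⟨x₁, x₂, hx⟩ := exists_center_support_mem_Icc (h.radius_continuous ht)
    (fun θ => h.radius_pos θ ht) (h.radius_periodic ht)
    (fun θ => h.hasDerivAt_curveX_space (g := g) θ ht)
    (fun θ => h.hasDerivAt_curveY_space θ ht)
    (h.curveX_periodic hsin ht) (h.curveY_periodic hcos ht)
  have hLt := h.integral_radius_le_initial hsin hcos ht
  have hlow : ∀ θ, 2 * ρ ≤ support b g U U₁ θ t - (x₁ * Real.cos θ + x₂ * Real.sin θ) :=
    fun θ => by
      refine le_trans ?_ (hx θ).1
      have e : 2 * ρ = c / L := by rw [hρ]; field_simp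
      rw [e]
      exact div_le_div₀ (hc.le.trans (harea t ht)) (harea t ht) (hlen t ht) hLt
  have := h.speed_lt_mul_support hsin hcos ht hρpos hM hm hB₁ hB₂ hlow θ
  have hup : support b g U U₁ θ t - (x₁ * Real.cos θ + x₂ * Real.sin θ) ≤ L :=
    (hx θ).2.trans hLt
  refine this.le.trans (mul_le_mul_of_nonneg_left ?_ hBpos.le)
  linarith

end IsSpeedSolution

/-! ### Reduction of the homothetic Minkowskian flow to the normalized flow -/

theorem hasDerivAt_of_contDiff_two {p : ℝ → ℝ} (hp : ContDiff ℝ 2 p) (θ : ℝ) :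
    HasDerivAt p (deriv p θ) θ ∧ HasDerivAt (deriv p) (iteratedDeriv 2 p θ) θ := by
  have h1 : Differentiable ℝ (deriv p) :=
    ((contDiff_succ_iff_deriv (n := 1)).1 hp).2.2.differentiable (by simp)
  refine ⟨(hp.differentiable (by simp) θ).hasDerivAt, ?_⟩
  rw [iteratedDeriv_succ, iteratedDeriv_one]
  exact (h1 θ).hasDerivAt

theorem dθ_homothetic (f a₀ : ℝ → ℝ) (θ t : ℝ) :
    dθ (homothetic f a₀) θ t = f t * deriv a₀ θ := by
  simp [dθ, homothetic]

theorem dθθ_homothetic (f a₀ : ℝ → ℝ) (θ t : ℝ) :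
    dθθ (homothetic f a₀) θ t = f t * iteratedDeriv 2 a₀ θ := by
  have : deriv (fun σ => f t * a₀ σ) = fun σ => f t * deriv a₀ σ := by
    ext σ; simp
  simp only [dθθ, homothetic]
  rw [iteratedDeriv_succ, iteratedDeriv_one, this, iteratedDeriv_succ, iteratedDeriv_one]
  simp

/-- `(k / f) a₀`, the Euclidean normal speed rescaled by `f`. -/
def speed (f a₀ : ℝ → ℝ) (k : ℝ → ℝ → ℝ) (θ t : ℝ) : ℝ := a₀ θ * k θ t / f t

/-- Spatial derivative of `speed`. -/
def speed₁ (f a₀ : ℝ → ℝ) (k : ℝ → ℝ → ℝ) (θ t : ℝ) : ℝ :=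
  (deriv a₀ θ * k θ t + a₀ θ * dθ k θ t) / f t

/-- Second spatial derivative of `speed`. -/
def speed₂ (f a₀ : ℝ → ℝ) (k : ℝ → ℝ → ℝ) (θ t : ℝ) : ℝ :=
  (iteratedDeriv 2 a₀ θ * k θ t + deriv a₀ θ * dθ k θ t +
    (deriv a₀ θ * dθ k θ t + a₀ θ * dθθ k θ t)) / f t

section Homothetic

variable {a₀ f : ℝ → ℝ} {T : ℝ} {k : ℝ → ℝ → ℝ}

theorem radius_speed_eq (hpos : ∀ θ, 0 < a₀ θ) (θ : ℝ) {t : ℝ} :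
    radius (fun θ => a₀ θ * (a₀ θ + iteratedDeriv 2 a₀ θ)) (speed f a₀ k) θ t =
      (homothetic f a₀ θ t + dθθ (homothetic f a₀) θ t) / k θ t := by
  rw [dθθ_homothetic]
  simp only [radius, speed, homothetic]
  rw [div_div_eq_mul_div, mul_assoc, mul_div_mul_left _ _ (hpos θ).ne']
  ring

/-- The logarithm separates `f` from the spatial factor, so the coefficient is independent of `θ`;
this is what division of `k` by `f` removes. -/
theorem dt_log_homothetic (hconv : ∀ θ, 0 < a₀ θ + iteratedDeriv 2 a₀ θ)
    {f' : ℝ} (θ : ℝ) {t : ℝ} (ht : t ∈ Ioo 0 T) (hft : 0 < f t) (hf : HasDerivAt f f' t) :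
    dt T (fun φ s => Real.log (homothetic f a₀ φ s + dθθ (homothetic f a₀) φ s)) θ t =
      f' / f t := by
  have e : (fun s => Real.log (homothetic f a₀ θ s + dθθ (homothetic f a₀) θ s)) =
      fun s => Real.log (f s * (a₀ θ + iteratedDeriv 2 a₀ θ)) := by
    ext s
    rw [dθθ_homothetic, homothetic, mul_add]
  have hc := hconv θ
  have hd := (hf.mul_const (a₀ θ + iteratedDeriv 2 a₀ θ)).log (mul_pos hft hc).ne'
  simp only [dt]
  rw [e, hd.hasDerivWithinAt.derivWithin (uniqueDiffOn_Ico 0 T t ⟨ht.1.le, ht.2⟩)]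
  field_simp

theorem IsC21.hasDerivAt_time (hk : IsC21 T k) (θ : ℝ) {t : ℝ} (ht : t ∈ Ioo 0 T) :
    HasDerivAt (fun s => k θ s) (dt T k θ t) t :=
  ((hk.differentiable_time θ t ⟨ht.1.le, ht.2⟩).hasDerivWithinAt).hasDerivAt
    (Ico_mem_nhds ht.1 ht.2)

/-- The spatial terms combine through `a₀ k'' + 2 a₀' k' + (a₀ + a₀'') k = (a₀ k)'' + a₀ k`, and
differentiating `1 / f` cancels the logarithmic term. -/
theorem IsCurvatureSolution.isSpeedSolution (ha : ContDiff ℝ 2 a₀)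
    (hper : Function.Periodic a₀ (2 * Real.pi)) (hpos : ∀ θ, 0 < a₀ θ)
    (hconv : ∀ θ, 0 < a₀ θ + iteratedDeriv 2 a₀ θ) (hf : ContinuousOn f (Ico 0 T))
    (hfd : ∀ t ∈ Ioo 0 T, DifferentiableAt ℝ f t) (hfpos : ∀ t ∈ Ico 0 T, 0 < f t) (hT : 0 < T)
    (hk : IsCurvatureSolution (homothetic f a₀) T k) :
    IsSpeedSolution T (fun θ => a₀ θ * (a₀ θ + iteratedDeriv 2 a₀ θ)) (fun t => f t ^ 2)
      (speed f a₀ k) (speed₁ f a₀ k) (speed₂ f a₀ k) := by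
  have hc0 : Continuous a₀ := ha.continuous
  have hc1 : Continuous (deriv a₀) :=
    continuous_iff_continuousAt.2 fun θ => (hasDerivAt_of_contDiff_two ha θ).2.continuousAt
  have hc2 : Continuous (iteratedDeriv 2 a₀) := ha.continuous_iteratedDeriv 2 le_rfl
  have hper2 : Function.Periodic (iteratedDeriv 2 a₀) (2 * Real.pi) := fun θ => by
    rw [← congrFun (iteratedDeriv_comp_add_const 2 a₀ (2 * Real.pi)) θ, funext hper]
  have hf' : ContinuousOn (fun z : ℝ × ℝ => f z.2) (univ ×ˢ Ico 0 T) :=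
    hf.comp continuousOn_snd fun z hz => hz.2
  have hf0 : ∀ z ∈ (univ : Set ℝ) ×ˢ Ico 0 T, f z.2 ≠ 0 := fun z hz => (hfpos _ hz.2).ne'
  have hcf : ∀ {p : ℝ → ℝ}, Continuous p →
      ContinuousOn (fun z : ℝ × ℝ => p z.1) (univ ×ˢ Ico 0 T) :=
    fun hp => (hp.comp continuous_fst).continuousOn
  have R := hk.regular
  have hkd : ∀ t ∈ Ico 0 T, ∀ θ, HasDerivAt (fun φ => k φ t) (dθ k θ t) θ ∧
      HasDerivAt (fun φ => dθ k φ t) (dθθ k θ t) θ := fun t ht θ =>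
    hasDerivAt_of_contDiff_two (R.contDiff_space t ht) θ
  refine
    { b_continuous := hc0.mul (hc0.add hc2)
      b_periodic := hper.mul (hper.add hper2)
      b_pos := fun θ => mul_pos (hpos θ) (hconv θ)
      g_continuous := hf.pow 2
      g_pos := fun t ht => pow_pos (hfpos t ht) 2
      periodic := fun t ht θ => ?_
      hasDerivAt_space := fun t ht θ =>
        ((hasDerivAt_of_contDiff_two ha θ).1.mul (hkd t ht θ).1).div_const _
      hasDerivAt_space₁ := fun t ht θ =>
        (((hasDerivAt_of_contDiff_two ha θ).2.mul (hkd t ht θ).1).add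
          ((hasDerivAt_of_contDiff_two ha θ).1.mul (hkd t ht θ).2)).div_const _
      continuousOn := ((hcf hc0).mul R.continuous).div hf' hf0
      continuousOn₁ := (((hcf hc1).mul R.continuous).add
        ((hcf hc0).mul R.continuous_dθ)).div hf' hf0
      continuousOn₂ := ((((hcf hc2).mul R.continuous).add ((hcf hc1).mul R.continuous_dθ)).add
        (((hcf hc1).mul R.continuous_dθ).add ((hcf hc0).mul R.continuous_dθθ))).div hf' hf0
      evolution := fun θ t ht => ?_
      initial_pos := fun θ => div_pos (mul_pos (hpos θ) (hk.initial_pos θ))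
        (hfpos 0 ⟨le_rfl, hT⟩) }
  · have := R.periodic t ht θ
    simp only at this
    simp only [speed]
    rw [this, hper θ]
  · have ht' : t ∈ Ico 0 T := ⟨ht.1.le, ht.2⟩
    have hft := hfpos t ht'
    have hd := (hfd t ht).hasDerivAt
    have hev := hk.evolution θ t ht'
    rw [dt_log_homothetic hconv θ ht hft hd, dθθ_homothetic, dθ_homothetic] at hev
    have h0 := hpos θ
    have hh := hconv θ
    refine (((R.hasDerivAt_time θ ht).const_mul (a₀ θ)).div hd hft.ne').congr_deriv ?_
    rw [hev]
    simp only [homothetic, speed, speed₂]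
    rw [← mul_add]
    field_simp
    ring

/-- The radii agree and `f² U = a k`, so the motions of the base point agree as well. -/
theorem curve_homothetic_eq (hpos : ∀ θ, 0 < a₀ θ)
    (hfpos : ∀ t ∈ Ico 0 T, 0 < f t) (θ : ℝ) {t : ℝ} (ht : t ∈ Ico 0 T) :
    curve (homothetic f a₀) k θ t =
      (curveX (fun θ => a₀ θ * (a₀ θ + iteratedDeriv 2 a₀ θ)) (fun t => f t ^ 2)
        (speed f a₀ k) θ t,
      curveY (fun θ => a₀ θ * (a₀ θ + iteratedDeriv 2 a₀ θ)) (fun t => f t ^ 2)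
        (speed f a₀ k) (speed₁ f a₀ k) θ t) := by
  have hf0 : ∀ s ∈ uIcc 0 t, f s ≠ 0 := fun s hs => by
    rw [uIcc_of_le ht.1] at hs
    exact (hfpos s ⟨hs.1, hs.2.trans_lt ht.2⟩).ne'
  simp only [curve, curveX, curveY, radius_speed_eq hpos]
  congr 2
  · refine intervalIntegral.integral_congr fun s hs => ?_
    have := hf0 s hs
    simp only [homothetic, speed]
    field_simp
  · refine intervalIntegral.integral_congr fun s hs => ?_
    have := hf0 s hs
    simp only [dθ_homothetic]
    simp only [homothetic, speed₁]
    field_simp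
    ring

/-- The tangent is `r (-sin θ, cos θ)`, and its bracket with the position is `r` times the support
function. -/
theorem IsSpeedSolution.enclosedArea_eq {b g : ℝ → ℝ} {U U₁ U₂ : ℝ → ℝ → ℝ}
    (h : IsSpeedSolution T b g U U₁ U₂) {t : ℝ} (ht : t ∈ Ico 0 T) :
    enclosedArea (fun θ => (curveX b g U θ t, curveY b g U U₁ θ t)) =
      1 / 2 * ∫ θ in (0 : ℝ)..(2 * Real.pi), radius b U θ t * support b g U U₁ θ t := by
  simp only [enclosedArea]
  congr 1
  refine intervalIntegral.integral_congr fun θ _ => ?_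
  rw [((h.hasDerivAt_curveX_space θ ht).prodMk (h.hasDerivAt_curveY_space θ ht)).deriv]
  simp only [bracket, support]
  ring

end Homothetic

end

end MinkowskiFlow

theorem theorem3p1 (a₀ f : ℝ → ℝ) (T : ℝ) (k : ℝ → ℝ → ℝ)
    (ha₀_smooth : ContDiff ℝ ∞ a₀)
    (ha₀_periodic : Function.Periodic a₀ Real.pi)
    (ha₀_pos : ∀ θ, 0 < a₀ θ)
    (ha₀_convex : ∀ θ, 0 < a₀ θ + iteratedDeriv 2 a₀ θ)
    (hf_smooth : ContDiffOn ℝ ∞ f (Set.Ici 0))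
    (hf_pos : ∀ t ∈ Set.Ici (0 : ℝ), 0 < f t)
    (hf_mono : MonotoneOn f (Set.Ici 0))
    (hf_zero : f 0 = 1)
    (hT : 0 < T)
    (hk : MinkowskiFlow.IsCurvatureSolution (MinkowskiFlow.homothetic f a₀) T k)
    (hA : ∃ c : ℝ, 0 < c ∧ ∀ t ∈ Set.Ico 0 T, c ≤ MinkowskiFlow.enclosedArea
      (fun θ => MinkowskiFlow.curve (MinkowskiFlow.homothetic f a₀) k θ t)) :
    ∃ C : ℝ, ∀ θ : ℝ, ∀ t ∈ Set.Ico 0 T, |k θ t| ≤ C := by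
  obtain ⟨c, hc, hA⟩ := hA
  have ha : ContDiff ℝ 2 a₀ := contDiff_infty.1 ha₀_smooth 2
  have hper : Function.Periodic a₀ (2 * Real.pi) := by
    simpa using ha₀_periodic.nat_mul 2
  have hfpos : ∀ t ∈ Ico 0 T, 0 < f t := fun t ht => hf_pos t ht.1
  have h := hk.isSpeedSolution ha hper ha₀_pos ha₀_convex
    (hf_smooth.continuousOn.mono fun t ht => ht.1)
    (fun t ht => ((hf_smooth.differentiableOn (by simp)) t ht.1.le).differentiableAt
      (Ici_mem_nhds ht.1)) hfpos hT
  obtain ⟨C, hC⟩ := h.exists_bound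
    (by simpa only [MinkowskiFlow.radius_speed_eq ha₀_pos] using hk.initial_closed_sin)
    (by simpa only [MinkowskiFlow.radius_speed_eq ha₀_pos] using hk.initial_closed_cos) hc
    (fun t ht => by
      rw [← h.enclosedArea_eq ht]
      refine (hA t ht).trans_eq ?_
      congr 1
      exact funext fun θ => MinkowskiFlow.curve_homothetic_eq ha₀_pos hfpos θ ht)
  obtain ⟨θ₀, hθ₀⟩ := MinkowskiFlow.exists_forall_le_of_periodic
    (ha.continuous.inv₀ fun θ => (ha₀_pos θ).ne') (fun θ => by simp [hper θ])
  -- Undoing `U = a₀ k / f`: `1 / a₀` is maximal at `θ₀`, and monotonicity bounds `f` on `[0, T)` by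
  -- its value at the finite time `T`.
  refine ⟨(a₀ θ₀)⁻¹ * f T * C, fun θ t ht => ?_⟩
  have hU := h.pos θ ht
  have ha' := ha₀_pos θ
  have hft := hfpos t ht
  have e : k θ t = (a₀ θ)⁻¹ * f t * MinkowskiFlow.speed f a₀ k θ t := by
    simp only [MinkowskiFlow.speed]
    field_simp
  rw [e, abs_of_pos (by positivity)]
  have hfT : f t ≤ f T := hf_mono ht.1 hT.le ht.2.le
  have := ha₀_pos θ₀
  exact mul_le_mul (mul_le_mul (hθ₀ θ) hfT hft.le (by positivity)) (hC θ t ht) hU.le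
    (mul_nonneg (by positivity) (hft.le.trans hfT))
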